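/- Let $f:\mathbb R\to(0,\infty)$ be a smooth function for which there are constants $0<m\le M<\infty$ with $m\le f\le M$, and let $g_f=-f(x)^2\,dt^2+dx^2$ be the associated Lorentzian metric on $\mathbb R^2$ with coordinates $(t,x)$. If $x_0\in\mathbb R$ satisfies $f(x_0)=\sup_{x\in\mathbb R}f(x)$ and $t_0\in\mathbb R$, then $p=(t_0,x_0)$ is a timelike pole of $(\mathbb R^2,g_f)$; that is, no timelike geodesic $\gamma:[0,a)\to\mathbb R^2$ ($0<a\le\infty$) with $\gamma(0)=p$ contains a pair of conjugate points: for any such $\gamma$ and any two distinct parameters $\tau_1,\tau_2\in[0,a)$, the only Jacobi field along $\gamma$ that vanishes at both $\tau_1$ and $\tau_2$ is the zero field. -/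

import Mathlib

open scoped ContDiff

noncomputable section

/-- A smooth Lorentzian metric on `ℝⁿ`, given by its components `g i j` in the standard
coordinates. The signature is `(-, +, …, +)`: at each point there is a timelike vector on whose
orthogonal complement the metric is positive definite. -/
structure LorentzMetric (n : ℕ) where
  comp : (Fin n → ℝ) → Matrix (Fin n) (Fin n) ℝ
  symm : ∀ p i j, comp p i j = comp p j i
  smooth : ∀ i j, ContDiff ℝ ∞ (fun p => comp p i j)
  signature : ∀ p, ∃ v : Fin n → ℝ,
    (∑ i, ∑ j, comp p i j * v i * v j) < 0 ∧
    ∀ w : Fin n → ℝ, w ≠ 0 → (∑ i, ∑ j, comp p i j * v i * w j) = 0 →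
      0 < ∑ i, ∑ j, comp p i j * w i * w j

/-- The partial derivative `∂ᵢ F` of a function on `ℝⁿ`. -/
def partialDeriv {n : ℕ} (i : Fin n) (F : (Fin n → ℝ) → ℝ) (p : Fin n → ℝ) : ℝ :=
  fderiv ℝ F p (Pi.single i 1)

namespace LorentzMetric

variable {n : ℕ} (g : LorentzMetric n)

/-- The scalar product `g_p(v, w)`. -/
def inner (p v w : Fin n → ℝ) : ℝ := ∑ i, ∑ j, g.comp p i j * v i * w j

/-- The Christoffel symbols `Γᵏᵢⱼ` of the Levi-Civita connection of `g`. -/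
def christoffel (k i j : Fin n) (p : Fin n → ℝ) : ℝ :=
  (1 / 2) * ∑ l, (g.comp p)⁻¹ k l *
    (partialDeriv i (fun q => g.comp q j l) p + partialDeriv j (fun q => g.comp q i l) p
      - partialDeriv l (fun q => g.comp q i j) p)

/-- The `l`-th component of `R(∂ᵢ, ∂ⱼ)∂ₖ`, where
`R(X, Y)Z = ∇_X ∇_Y Z - ∇_Y ∇_X Z - ∇_[X,Y] Z`. -/
def curvatureComp (l k i j : Fin n) (p : Fin n → ℝ) : ℝ :=
  partialDeriv i (g.christoffel l j k) p - partialDeriv j (g.christoffel l i k) p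
    + ∑ m, (g.christoffel l i m p * g.christoffel m j k p
      - g.christoffel l j m p * g.christoffel m i k p)

/-- The curvature vector `R(u, v)w` at the point `p`. -/
def curvature (p u v w : Fin n → ℝ) : Fin n → ℝ := fun l =>
  ∑ i, ∑ j, ∑ k, g.curvatureComp l k i j p * u i * v j * w k

/-- The covariant derivative `DV/dτ` of a vector field `V` along a curve `γ` that is defined on
the set `I` of parameters. -/
def covDeriv (I : Set ℝ) (γ V : ℝ → Fin n → ℝ) (τ : ℝ) : Fin n → ℝ := fun k =>
  derivWithin V I τ k +
    ∑ i, ∑ j, g.christoffel k i j (γ τ) * derivWithin γ I τ i * V τ j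

/-- `γ : I → ℝⁿ` is a geodesic of `g`: a smooth curve whose velocity is parallel. -/
def IsGeodesicOn (I : Set ℝ) (γ : ℝ → Fin n → ℝ) : Prop :=
  ContDiffOn ℝ ∞ γ I ∧ ∀ τ ∈ I, g.covDeriv I γ (derivWithin γ I) τ = 0

/-- `γ : I → ℝⁿ` is timelike: all its velocity vectors are timelike. -/
def IsTimelikeOn (I : Set ℝ) (γ : ℝ → Fin n → ℝ) : Prop :=
  ∀ τ ∈ I, g.inner (γ τ) (derivWithin γ I τ) (derivWithin γ I τ) < 0

/-- `J` is a Jacobi field along `γ : I → ℝⁿ`: it is smooth and `D²J/dτ² + R(J, γ')γ' = 0`. -/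
def IsJacobiFieldOn (I : Set ℝ) (γ J : ℝ → Fin n → ℝ) : Prop :=
  ContDiffOn ℝ ∞ J I ∧
    ∀ τ ∈ I, g.covDeriv I γ (g.covDeriv I γ J) τ
      + g.curvature (γ τ) (J τ) (derivWithin γ I τ) (derivWithin γ I τ) = 0

/-- The points with parameters `τ₁ ≠ τ₂` are conjugate along `γ : I → ℝⁿ`: some Jacobi field
along `γ` that is not identically zero vanishes at both of them. -/
def AreConjugateOn (I : Set ℝ) (γ : ℝ → Fin n → ℝ) (τ₁ τ₂ : ℝ) : Prop :=
  τ₁ ≠ τ₂ ∧ ∃ J : ℝ → Fin n → ℝ, g.IsJacobiFieldOn I γ J ∧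
    J τ₁ = 0 ∧ J τ₂ = 0 ∧ ∃ τ ∈ I, J τ ≠ 0

/-- The interval `[0, a)`, where `0 < a ≤ ∞` is allowed. -/
def halfOpen (a : EReal) : Set ℝ := {τ | 0 ≤ τ ∧ (τ : EReal) < a}

/-- `p` is a timelike pole of `g`: no timelike geodesic `γ : [0, a) → ℝⁿ`, `0 < a ≤ ∞`, with
`γ 0 = p` contains a pair of conjugate points. -/
def IsTimelikePole (p : Fin n → ℝ) : Prop :=
  ∀ (a : EReal) (γ : ℝ → Fin n → ℝ), 0 < a →
    g.IsGeodesicOn (halfOpen a) γ → g.IsTimelikeOn (halfOpen a) γ → γ 0 = p →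
    ∀ τ₁ ∈ halfOpen a, ∀ τ₂ ∈ halfOpen a, ¬ g.AreConjugateOn (halfOpen a) γ τ₁ τ₂

end LorentzMetric

/-- The Lorentzian metric `g_f = -f(x)² dt² + dx²` on the plane; the coordinates of a point `p`
are `t = p 0` and `x = p 1`. -/
def planeMetric (f : ℝ → ℝ) (hf : ContDiff ℝ ∞ f) (hpos : ∀ x, 0 < f x) : LorentzMetric 2 where
  comp p := !![-(f (p 1)) ^ 2, 0; 0, 1]
  symm p i j := by fin_cases i <;> fin_cases j <;> simp
  smooth i j := by
    have h : ContDiff ℝ ∞ (fun p : Fin 2 → ℝ => f (p 1)) := hf.comp (contDiff_apply ℝ ℝ 1)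
    fin_cases i <;> fin_cases j <;> simp <;> first | exact (h.pow 2).neg | exact contDiff_const
  signature p := by
    have h := hpos (p 1)
    refine ⟨![1, 0], by simp [Fin.sum_univ_two]; positivity, fun w hw h0 => ?_⟩
    simp [Fin.sum_univ_two, h.ne'] at h0
    have h1 : w 1 ≠ 0 := by
      intro h1
      apply hw
      ext i
      fin_cases i <;> simp [h0, h1]
    simp [Fin.sum_univ_two, h0, h1]

end

/-! Along a timelike geodesic `(T, X)` the momentum `f² T'` and the energy `E = X'² - (f T')² < 0`
are conserved. The component of a Jacobi field along the velocity is affine in the parameter, so two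
zeros kill it. The component `u` along the parallel normal field satisfies `u'' = (f'' / f) E u`,
and by Sturm's argument (`Convex.eq_zero_of_nonvanishing_solution`) two zeros kill it once this
equation has a nowhere vanishing solution.

`exists_nonvanishing_solution` finds one. If `X' 0 ≠ 0`, take `f X'`, up to sign the normal
component of the Killing field `∂ₜ`: since `f` is maximal at the start, `|f T'|` is minimal there,
and conservation of energy keeps `X'²` at least `X'(0)²`. If `X' 0 = 0`, the geodesic stays on the
line `x = x₀`, the coefficient is a constant `q ≥ 0` because `f''(x₀) ≤ 0` and `E < 0`, and `exp (√q
τ)` works. -/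

/-! ### Scalar differential equations on an interval. -/

theorem Convex.eq_of_hasDerivWithinAt_zero {I : Set ℝ} (hI : Convex ℝ I) {F : ℝ → ℝ}
    (hF : ∀ τ ∈ I, HasDerivWithinAt F 0 I τ) {σ τ : ℝ} (hσ : σ ∈ I) (hτ : τ ∈ I) :
    F σ = F τ := by
  have := hI.norm_image_sub_le_of_norm_hasDerivWithin_le (C := 0) hF (by simp) hτ hσ
  simpa [sub_eq_zero] using this

theorem Convex.exists_deriv_eq_zero_of_hasDerivWithinAt {I : Set ℝ} (hI : Convex ℝ I)
    {F F' : ℝ → ℝ} (hF : ∀ τ ∈ I, HasDerivWithinAt F (F' τ) I τ) {a b : ℝ} (ha : a ∈ I)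
    (hb : b ∈ I) (hab : a ≠ b) (h : F a = F b) : ∃ c ∈ I, F' c = 0 := by
  wlog hlt : a < b generalizing a b
  · exact this hb ha hab.symm h.symm (lt_of_le_of_ne (not_lt.1 hlt) hab.symm)
  have hsub : Set.Icc a b ⊆ I := hI.ordConnected.out ha hb
  obtain ⟨c, hc, h0⟩ := exists_hasDerivAt_eq_zero hlt
    (fun τ hτ => ((hF τ (hsub hτ)).continuousWithinAt).mono hsub) h
    (fun τ hτ => (hF τ (hsub (Set.Ioo_subset_Icc_self hτ))).hasDerivAt
      (Filter.mem_of_superset (Icc_mem_nhds hτ.1 hτ.2) hsub))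
  exact ⟨c, hsub (Set.Ioo_subset_Icc_self hc), h0⟩

/-- A function with vanishing second derivative and two distinct zeros vanishes. -/
theorem Convex.eq_zero_of_second_deriv_zero {I : Set ℝ} (hI : Convex ℝ I) {s s' : ℝ → ℝ}
    (hs : ∀ τ ∈ I, HasDerivWithinAt s (s' τ) I τ)
    (hs' : ∀ τ ∈ I, HasDerivWithinAt s' 0 I τ) {a b : ℝ} (ha : a ∈ I) (hb : b ∈ I)
    (hab : a ≠ b) (hsa : s a = 0) (hsb : s b = 0) {τ : ℝ} (hτ : τ ∈ I) : s τ = 0 := by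
  obtain ⟨c, hc, h0⟩ := hI.exists_deriv_eq_zero_of_hasDerivWithinAt hs ha hb hab (hsa.trans hsb.symm)
  rw [← hsa]
  refine hI.eq_of_hasDerivWithinAt_zero (fun σ hσ => ?_) hτ ha
  rw [← h0, ← hI.eq_of_hasDerivWithinAt_zero hs' hσ hc]
  exact hs σ hσ

/-- If `v'' = q v` has a solution without zeros, then no nontrivial solution of `u'' = q u` has
two distinct zeros. -/
theorem Convex.eq_zero_of_nonvanishing_solution {I : Set ℝ} (hI : Convex ℝ I)
    {q u u' v v' : ℝ → ℝ}
    (hu : ∀ τ ∈ I, HasDerivWithinAt u (u' τ) I τ)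
    (hu' : ∀ τ ∈ I, HasDerivWithinAt u' (q τ * u τ) I τ)
    (hv : ∀ τ ∈ I, HasDerivWithinAt v (v' τ) I τ)
    (hv' : ∀ τ ∈ I, HasDerivWithinAt v' (q τ * v τ) I τ) (hv0 : ∀ τ ∈ I, v τ ≠ 0)
    {a b : ℝ} (ha : a ∈ I) (hb : b ∈ I)
    (hab : a ≠ b) (hua : u a = 0) (hub : u b = 0) {τ : ℝ} (hτ : τ ∈ I) : u τ = 0 := by
  -- The Wronskian is constant, and it is the numerator of `(u / v)'`. Rolle's theorem for `u / v`
  -- makes it zero at one point, hence everywhere.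
  have hw : ∀ σ ∈ I, HasDerivWithinAt (fun σ => u' σ * v σ - u σ * v' σ) 0 I σ := by
    intro σ hσ
    refine (((hu' σ hσ).mul (hv σ hσ)).sub ((hu σ hσ).mul (hv' σ hσ))).congr_deriv ?_
    ring
  have hquot : ∀ σ ∈ I, HasDerivWithinAt (fun σ => u σ / v σ)
      ((u' σ * v σ - u σ * v' σ) / v σ ^ 2) I σ :=
    fun σ hσ => (hu σ hσ).div (hv σ hσ) (hv0 σ hσ)
  obtain ⟨c, hc, h0⟩ := hI.exists_deriv_eq_zero_of_hasDerivWithinAt hquot ha hb hab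
    (by simp [hua, hub])
  have hw0 : u' c * v c - u c * v' c = 0 := by
    simpa [hv0 c hc] using h0
  have hconst : u τ / v τ = u a / v a := by
    refine hI.eq_of_hasDerivWithinAt_zero (F := fun σ => u σ / v σ) (fun σ hσ => ?_) hτ ha
    have h1 : u' σ * v σ - u σ * v' σ = 0 :=
      (hI.eq_of_hasDerivWithinAt_zero hw hσ hc).trans hw0
    simpa [h1] using hquot σ hσ
  simpa [hua, hv0 τ hτ] using hconst

/-- Uniqueness for `w'' = h` where `|h| ≤ C |w|` on each compact initial interval. -/
theorem eq_zero_of_abs_second_deriv_le {w w' h : ℝ → ℝ} {b C : ℝ}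
    (hw : ∀ τ ∈ Set.Icc 0 b, HasDerivWithinAt w (w' τ) (Set.Icc 0 b) τ)
    (hw' : ∀ τ ∈ Set.Icc 0 b, HasDerivWithinAt w' (h τ) (Set.Icc 0 b) τ)
    (hle : ∀ τ ∈ Set.Icc 0 b, |h τ| ≤ C * |w τ|) (h0 : w 0 = 0) (h0' : w' 0 = 0) :
    ∀ τ ∈ Set.Icc 0 b, w τ = 0 := by
  intro τ hτ
  have hd : ∀ τ ∈ Set.Icc 0 b,
      HasDerivWithinAt (fun τ => (w τ, w' τ)) (w' τ, h τ) (Set.Icc 0 b) τ :=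
    fun τ hτ => (hw τ hτ).prodMk (hw' τ hτ)
  -- Grönwall for the pair `(w, w')` in the sup norm: `1` bounds the first component of the
  -- derivative, `C` the second.
  have key := eq_zero_of_abs_deriv_le_mul_abs_self_of_eq_zero_right (K := max 1 C)
    (f := fun τ => (w τ, w' τ)) (f' := fun τ => (w' τ, h τ)) (a := 0) (b := b)
    (fun τ hτ => (hd τ hτ).continuousWithinAt)
    (fun τ hτ => (hd τ (Set.Ico_subset_Icc_self hτ)).mono_of_mem_nhdsWithin
      (Filter.mem_of_superset (Icc_mem_nhdsGE hτ.2) (Set.Icc_subset_Icc_left hτ.1)))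
    (by simp [h0, h0']) ?_ τ hτ
  · simpa using congrArg Prod.fst key
  · intro σ hσ
    have h1 := hle σ (Set.Ico_subset_Icc_self hσ)
    simp only [Prod.norm_mk, Real.norm_eq_abs]
    have h2 : |w σ| ≤ max |w σ| |w' σ| := le_max_left _ _
    have h3 : |w' σ| ≤ max |w σ| |w' σ| := le_max_right _ _
    have h4 : 0 ≤ max |w σ| |w' σ| := (abs_nonneg _).trans h2
    refine max_le (h3.trans (le_mul_of_one_le_left h4 (le_max_left _ _))) (h1.trans ?_)
    exact mul_le_mul (le_max_right _ _) h2 (abs_nonneg _) (zero_le_one.trans (le_max_left _ _))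

/-- A positive second derivative would make `x₀` also a local minimum, so `f` would be constant near
`x₀` and its second derivative zero. -/
theorem deriv_deriv_nonpos_of_forall_le {f : ℝ → ℝ} {x₀ : ℝ} (hc : Continuous f)
    (hmax : ∀ x, f x ≤ f x₀) : deriv (deriv f) x₀ ≤ 0 := by
  by_contra! hpos
  have hd : deriv f x₀ = 0 := IsLocalMax.deriv_eq_zero (Filter.Eventually.of_forall hmax)
  have hmin := isLocalMin_of_deriv_deriv_pos hpos hd hc.continuousAt
  have heq : f =ᶠ[nhds x₀] fun _ => f x₀ := by
    filter_upwards [hmin] with x hx using le_antisymm (hmax x) hx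
  rw [heq.deriv.deriv_eq] at hpos
  simp at hpos

theorem LorentzMetric.convex_halfOpen (a : EReal) : Convex ℝ (LorentzMetric.halfOpen a) := by
  refine Set.OrdConnected.convex ⟨fun x hx y hy z hz => ⟨hx.1.trans hz.1, ?_⟩⟩
  exact lt_of_le_of_lt (EReal.coe_le_coe_iff.2 hz.2) hy.2

/-- Needed for `derivWithin` of a smooth curve to be smooth again. As `a` may be `∞`, a real `b` in
`(0, a)` supplies the interior points. -/
theorem LorentzMetric.uniqueDiffOn_halfOpen {a : EReal} (ha : 0 < a) :
    UniqueDiffOn ℝ (LorentzMetric.halfOpen a) := by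
  refine uniqueDiffOn_convex (LorentzMetric.convex_halfOpen a) ?_
  obtain ⟨b, hb0, hba⟩ := EReal.lt_iff_exists_real_btwn.1 ha
  have hb : (0 : ℝ) < b := by exact_mod_cast hb0
  refine ((Set.nonempty_Ioo.2 hb).mono ?_)
  rw [← interior_Icc]
  exact interior_mono fun x hx => ⟨hx.1, lt_of_le_of_lt (EReal.coe_le_coe_iff.2 hx.2) hba⟩

/-! ### Christoffel symbols and curvature of the plane metric. -/

section
variable {f : ℝ → ℝ} (hf : ContDiff ℝ ∞ f) (hpos : ∀ x, 0 < f x)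

theorem partialDeriv_comp_snd {h : ℝ → ℝ} (p : Fin 2 → ℝ) (hh : DifferentiableAt ℝ h (p 1))
    (i : Fin 2) : partialDeriv i (fun q => h (q 1)) p = if i = 1 then deriv h (p 1) else 0 := by
  have h1 : HasFDerivAt (fun q : Fin 2 → ℝ => h (q 1))
      (deriv h (p 1) • ContinuousLinearMap.proj (R := ℝ) (φ := fun _ : Fin 2 => ℝ) 1) p :=
    hh.hasDerivAt.comp_hasFDerivAt p
      (ContinuousLinearMap.proj (R := ℝ) (φ := fun _ : Fin 2 => ℝ) 1).hasFDerivAt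
  rw [partialDeriv, h1.fderiv]
  fin_cases i <;> simp

theorem partialDeriv_const {n : ℕ} (c : ℝ) (p : Fin n → ℝ) (i : Fin n) :
    partialDeriv i (fun _ => c) p = 0 := by
  simp [partialDeriv]

theorem planeMetric_partialDeriv (i j l : Fin 2) (p : Fin 2 → ℝ) :
    partialDeriv i (fun q => (planeMetric f hf hpos).comp q j l) p =
      if i = 1 ∧ j = 0 ∧ l = 0 then -(2 * f (p 1) * deriv f (p 1)) else 0 := by
  have hd : DifferentiableAt ℝ f (p 1) := hf.differentiable (by simp) _
  have h1 : deriv (fun x => -(f x) ^ 2) (p 1) = -(2 * f (p 1) * deriv f (p 1)) := by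
    have h := (hd.hasDerivAt.pow 2).neg
    exact (h.congr_deriv (by simp)).deriv
  have h2 := partialDeriv_comp_snd p (h := fun x => -(f x) ^ 2) (hd.pow 2).neg i
  rw [h1] at h2
  fin_cases j <;> fin_cases l <;> simp [planeMetric, partialDeriv_const]
  exact h2

theorem planeMetric_inv (p : Fin 2 → ℝ) :
    ((planeMetric f hf hpos).comp p)⁻¹ = !![-((f (p 1)) ^ 2)⁻¹, 0; 0, 1] := by
  have := (hpos (p 1)).ne'
  apply Matrix.inv_eq_right_inv
  ext i j
  fin_cases i <;> fin_cases j <;> simp [planeMetric, Matrix.mul_apply, this]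

/-- The Christoffel symbols of the metric `-f(x)² dt² + dx²` as functions of `x`. -/
noncomputable def planeChristoffel (f : ℝ → ℝ) (k i j : Fin 2) : ℝ → ℝ := fun x =>
  if k = 1 then (if i = 0 ∧ j = 0 then f x * deriv f x else 0)
  else if i = j then 0 else deriv f x / f x

theorem planeMetric_christoffel (k i j : Fin 2) :
    (planeMetric f hf hpos).christoffel k i j = fun p => planeChristoffel f k i j (p 1) := by
  ext p
  have := (hpos (p 1)).ne'
  simp only [LorentzMetric.christoffel, planeMetric_partialDeriv, planeMetric_inv,
    Fin.sum_univ_two]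
  fin_cases k <;> fin_cases i <;> fin_cases j <;> simp [planeChristoffel] <;> field_simp

theorem hasDerivAt_planeChristoffel (hf : ContDiff ℝ ∞ f) (hpos : ∀ x, 0 < f x) (k i j : Fin 2) (x : ℝ) :
    HasDerivAt (planeChristoffel f k i j)
      (if k = 1 then (if i = 0 ∧ j = 0 then deriv f x ^ 2 + f x * deriv (deriv f) x else 0)
        else if i = j then 0 else (deriv (deriv f) x * f x - deriv f x ^ 2) / f x ^ 2) x := by
  have h1 : HasDerivAt f (deriv f x) x := (hf.differentiable (by simp) x).hasDerivAt
  have h2 : HasDerivAt (deriv f) (deriv (deriv f) x) x :=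
    ((contDiff_infty_iff_deriv.1 hf).2.differentiable (by simp) x).hasDerivAt
  have h3 := h1.mul h2
  have h4 := h2.div h1 (hpos x).ne'
  unfold planeChristoffel
  fin_cases k <;> fin_cases i <;> fin_cases j <;> simp [hasDerivAt_const]
  · exact h4.congr_deriv (by ring)
  · exact h4.congr_deriv (by ring)
  · exact h3.congr_deriv (by ring)

/-- In dimension two `R(u, w)w = K (g(w, w) u - g(u, w) w)`, here with Gauss curvature `K = -f'' /
f`. -/
theorem planeMetric_curvature (p u w : Fin 2 → ℝ) :
    (planeMetric f hf hpos).curvature p u w w =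
      (-(deriv (deriv f) (p 1)) / f (p 1)) •
        ((-(f (p 1) * w 0) ^ 2 + w 1 ^ 2) • u
          - (-(f (p 1)) ^ 2 * u 0 * w 0 + u 1 * w 1) • w) := by
  have hne := (hpos (p 1)).ne'
  have hp (i l j k : Fin 2) :=
    partialDeriv_comp_snd p (hasDerivAt_planeChristoffel hf hpos l j k (p 1)).differentiableAt i
  have hd (l j k : Fin 2) := (hasDerivAt_planeChristoffel hf hpos l j k (p 1)).deriv
  ext l
  simp only [LorentzMetric.curvature, LorentzMetric.curvatureComp, planeMetric_christoffel,
    hp, hd, Fin.sum_univ_two]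
  fin_cases l <;> simp [planeChristoffel] <;> field_simp <;> ring

theorem planeMetric_covDeriv (I : Set ℝ) (γ V : ℝ → Fin 2 → ℝ) (τ : ℝ) :
    (planeMetric f hf hpos).covDeriv I γ V τ =
      ![derivWithin V I τ 0 + deriv f (γ τ 1) / f (γ τ 1) *
          (derivWithin γ I τ 0 * V τ 1 + derivWithin γ I τ 1 * V τ 0),
        derivWithin V I τ 1 + f (γ τ 1) * deriv f (γ τ 1) * derivWithin γ I τ 0 * V τ 0] := by
  ext l
  simp only [LorentzMetric.covDeriv, planeMetric_christoffel, Fin.sum_univ_two]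
  fin_cases l <;> simp [planeChristoffel]
  ring

theorem planeMetric_inner (p v w : Fin 2 → ℝ) :
    (planeMetric f hf hpos).inner p v w = -(f (p 1)) ^ 2 * v 0 * w 0 + v 1 * w 1 := by
  simp [LorentzMetric.inner, planeMetric, Fin.sum_univ_two]

end

/-! ### Geodesics and Jacobi fields as systems of scalar equations. -/

section
variable {f : ℝ → ℝ} {I : Set ℝ}

/-- The geodesic equations of `-f(x)² dt² + dx²` on `I`, for a curve with second coordinate `X`
and velocity `(T', X')`. -/
structure PlaneGeodesicSystem (f : ℝ → ℝ) (I : Set ℝ) (T' X X' : ℝ → ℝ) : Prop where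
  position : ∀ τ ∈ I, HasDerivWithinAt X (X' τ) I τ
  velocity_fst : ∀ τ ∈ I,
    HasDerivWithinAt T' (-(deriv f (X τ) / f (X τ) * (T' τ * X' τ + X' τ * T' τ))) I τ
  velocity_snd : ∀ τ ∈ I,
    HasDerivWithinAt X' (-(f (X τ) * deriv f (X τ) * T' τ * T' τ)) I τ

namespace PlaneGeodesicSystem

variable {T' X X' : ℝ → ℝ}

/-- Conservation law of the Killing field `∂ₜ`: the quantity is `-g(∂ₜ, γ')`. -/
theorem momentum_eq (H : PlaneGeodesicSystem f I T' X X') (hf : Differentiable ℝ f)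
    (hpos : ∀ x, 0 < f x) (hI : Convex ℝ I) {σ τ : ℝ} (hσ : σ ∈ I) (hτ : τ ∈ I) :
    f (X σ) ^ 2 * T' σ = f (X τ) ^ 2 * T' τ := by
  refine hI.eq_of_hasDerivWithinAt_zero (F := fun τ => f (X τ) ^ 2 * T' τ) (fun ρ hρ => ?_) hσ hτ
  have hfX := (hf (X ρ)).hasDerivAt.comp_hasDerivWithinAt ρ (H.position ρ hρ)
  refine ((hfX.pow 2).mul (H.velocity_fst ρ hρ)).congr_deriv ?_
  have := (hpos (X ρ)).ne'
  simp
  field_simp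
  ring

theorem energy_eq (H : PlaneGeodesicSystem f I T' X X') (hf : Differentiable ℝ f)
    (hpos : ∀ x, 0 < f x) (hI : Convex ℝ I) {σ τ : ℝ} (hσ : σ ∈ I) (hτ : τ ∈ I) :
    X' σ ^ 2 - (f (X σ) * T' σ) ^ 2 = X' τ ^ 2 - (f (X τ) * T' τ) ^ 2 := by
  refine hI.eq_of_hasDerivWithinAt_zero (F := fun τ => X' τ ^ 2 - (f (X τ) * T' τ) ^ 2)
    (fun ρ hρ => ?_) hσ hτ
  have hfX := (hf (X ρ)).hasDerivAt.comp_hasDerivWithinAt ρ (H.position ρ hρ)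
  refine (((H.velocity_snd ρ hρ).pow 2).sub
    ((hfX.mul (H.velocity_fst ρ hρ)).pow 2)).congr_deriv ?_
  have := (hpos (X ρ)).ne'
  simp
  field_simp
  ring

/-- A geodesic starting at a maximum of `f` does not move slower in the `x`-direction than
initially. -/
theorem sq_velocity_snd_le (H : PlaneGeodesicSystem f I T' X X') (hf : Differentiable ℝ f)
    (hpos : ∀ x, 0 < f x) (hI : Convex ℝ I) {σ τ : ℝ} (hσ : σ ∈ I) (hτ : τ ∈ I)
    (hmax : ∀ x, f x ≤ f (X σ)) : X' σ ^ 2 ≤ X' τ ^ 2 := by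
  have hE := H.energy_eq hf hpos hI hσ hτ
  have hc := H.momentum_eq hf hpos hI hσ hτ
  have h1 : f (X σ) * (f (X σ) * T' σ) = f (X τ) * (f (X τ) * T' τ) := by linarith
  have hle : |f (X σ) * T' σ| ≤ |f (X τ) * T' τ| := by
    have h2 := congrArg abs h1
    rw [abs_mul, abs_mul (f (X τ)), abs_of_pos (hpos (X σ)), abs_of_pos (hpos (X τ))] at h2
    refine le_of_mul_le_mul_left ?_ (hpos (X σ))
    rw [h2]
    exact mul_le_mul_of_nonneg_right (hmax _) (abs_nonneg _)
  have := sq_le_sq.2 hle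
  linarith

/-- A geodesic that starts at a critical point of `f` with velocity proportional to `∂ₜ` stays on
the vertical line. -/
theorem position_eq (H : PlaneGeodesicSystem f I T' X X') (hf : ContDiff ℝ ∞ f)
    (hI : Convex ℝ I) (h0 : 0 ∈ I) (hcrit : deriv f (X 0) = 0) (hX'0 : X' 0 = 0)
    {τ : ℝ} (hτ : τ ∈ I) (hτ0 : 0 ≤ τ) : X τ = X 0 := by
  have hsub : Set.Icc 0 τ ⊆ I := hI.ordConnected.out h0 hτ
  have hXc : ContinuousOn X (Set.Icc 0 τ) :=
    fun σ hσ => ((H.position σ (hsub hσ)).mono hsub).continuousWithinAt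
  have hTc : ContinuousOn T' (Set.Icc 0 τ) :=
    fun σ hσ => ((H.velocity_fst σ (hsub hσ)).mono hsub).continuousWithinAt
  obtain ⟨C, hC⟩ := isCompact_Icc.exists_bound_of_continuousOn hTc
  have hk : ContDiff ℝ 1 (fun x => f x * deriv f x) :=
    (hf.of_le (by simp)).mul ((contDiff_infty_iff_deriv.1 hf).2.of_le (by simp))
  -- As `f f'` vanishes at `X 0`, its Lipschitz constant `K` on the compact image of `X` bounds it
  -- by `K |X - X 0|`; `C` bounds `|T'|`.
  obtain ⟨K, hK⟩ := LocallyLipschitzOn.exists_lipschitzOnWith_of_compact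
    (isCompact_Icc.image_of_continuousOn hXc) (hk.locallyLipschitz.locallyLipschitzOn)
  have hmem0 : (0 : ℝ) ∈ Set.Icc 0 τ := ⟨le_rfl, hτ0⟩
  have key := eq_zero_of_abs_second_deriv_le (w := fun σ => X σ - X 0) (w' := X')
    (h := fun σ => -(f (X σ) * deriv f (X σ) * T' σ * T' σ)) (b := τ) (C := K * C * C)
    (fun σ hσ => ((H.position σ (hsub hσ)).mono hsub).sub_const _)
    (fun σ hσ => (H.velocity_snd σ (hsub hσ)).mono hsub) ?_ (by simp) hX'0 τ ⟨hτ0, le_rfl⟩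
  · exact sub_eq_zero.1 key
  · intro σ hσ
    have h1 := hK.norm_sub_le (Set.mem_image_of_mem X hσ) (Set.mem_image_of_mem X hmem0)
    have h2 := hC σ hσ
    simp only [hcrit, mul_zero, sub_zero, Real.norm_eq_abs] at h1 h2
    have hC0 : 0 ≤ C := (abs_nonneg _).trans h2
    calc |(-(f (X σ) * deriv f (X σ) * T' σ * T' σ))|
        = |f (X σ) * deriv f (X σ)| * |T' σ| * |T' σ| := by rw [abs_neg, abs_mul, abs_mul]
      _ ≤ (K * |X σ - X 0|) * C * C := by gcongr
      _ = K * C * C * |X σ - X 0| := by ring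

/-- The scalar Jacobi equation along a timelike geodesic that starts at a maximum of `f` has a
solution without zeros. -/
theorem exists_nonvanishing_solution (H : PlaneGeodesicSystem f I T' X X') (hf : ContDiff ℝ ∞ f)
    (hpos : ∀ x, 0 < f x) (hI : Convex ℝ I) (h0 : 0 ∈ I) (hnonneg : ∀ τ ∈ I, 0 ≤ τ)
    (hmax : ∀ x, f x ≤ f (X 0)) {E : ℝ} (hE : E < 0)
    (hEq : ∀ τ ∈ I, X' τ ^ 2 - (f (X τ) * T' τ) ^ 2 = E) :
    ∃ v v' : ℝ → ℝ, (∀ τ ∈ I, HasDerivWithinAt v (v' τ) I τ) ∧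
      (∀ τ ∈ I, HasDerivWithinAt v' (deriv (deriv f) (X τ) / f (X τ) * E * v τ) I τ) ∧
      ∀ τ ∈ I, v τ ≠ 0 := by
  have hfd : Differentiable ℝ f := hf.differentiable (by simp)
  have hf'd : Differentiable ℝ (deriv f) :=
    (contDiff_infty_iff_deriv.1 hf).2.differentiable (by simp)
  by_cases hX' : X' 0 = 0
  · have hcrit : deriv f (X 0) = 0 := IsLocalMax.deriv_eq_zero (Filter.Eventually.of_forall hmax)
    have hf'' := deriv_deriv_nonpos_of_forall_le hf.continuous hmax
    set q := deriv (deriv f) (X 0) / f (X 0) * E with hq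
    have hq0 : 0 ≤ q :=
      mul_nonneg_of_nonpos_of_nonpos (div_nonpos_of_nonpos_of_nonneg hf'' (hpos _).le) hE.le
    have hexp : ∀ τ, HasDerivAt (fun τ => Real.exp (√q * τ)) (√q * Real.exp (√q * τ)) τ := by
      intro τ
      exact (((hasDerivAt_id τ).const_mul √q).exp).congr_deriv (by simp; ring)
    refine ⟨fun τ => Real.exp (√q * τ), fun τ => √q * Real.exp (√q * τ),
      fun τ _ => (hexp τ).hasDerivWithinAt, fun τ hτ => ?_, fun τ _ => (Real.exp_pos _).ne'⟩
    refine ((hexp τ).const_mul √q).hasDerivWithinAt.congr_deriv ?_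
    rw [H.position_eq hf hI h0 hcrit hX' hτ (hnonneg τ hτ), ← hq, ← mul_assoc,
      Real.mul_self_sqrt hq0]
  · refine ⟨fun τ => f (X τ) * X' τ, fun τ => deriv f (X τ) * E, fun τ hτ => ?_,
      fun τ hτ => ?_, fun τ hτ => mul_ne_zero (hpos _).ne' fun h => ?_⟩
    · have hfX := (hfd (X τ)).hasDerivAt.comp_hasDerivWithinAt τ (H.position τ hτ)
      refine (hfX.mul (H.velocity_snd τ hτ)).congr_deriv ?_
      rw [← hEq τ hτ]
      simp
      ring
    · have hfX := (hf'd (X τ)).hasDerivAt.comp_hasDerivWithinAt τ (H.position τ hτ)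
      refine (hfX.mul_const E).congr_deriv ?_
      have := (hpos (X τ)).ne'
      field_simp
    · have h1 := H.sq_velocity_snd_le hfd hpos hI h0 hτ hmax
      rw [h] at h1
      have : 0 < X' 0 ^ 2 := by positivity
      linarith

/-- If `P, Q` are the components of the covariant derivative of the field `(A, B)`, then the
scalar product of `(A, B)` with the velocity can be differentiated by the product rule. -/
theorem hasDerivWithinAt_tangential (H : PlaneGeodesicSystem f I T' X X')
    (hf : Differentiable ℝ f) (hpos : ∀ x, 0 < f x) {A B : ℝ → ℝ} {P Q τ : ℝ} (hτ : τ ∈ I)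
    (hA : HasDerivWithinAt A
      (P - deriv f (X τ) / f (X τ) * (T' τ * B τ + X' τ * A τ)) I τ)
    (hB : HasDerivWithinAt B (Q - f (X τ) * deriv f (X τ) * T' τ * A τ) I τ) :
    HasDerivWithinAt (fun τ => -(f (X τ)) ^ 2 * A τ * T' τ + B τ * X' τ)
      (-(f (X τ)) ^ 2 * P * T' τ + Q * X' τ) I τ := by
  have hfX := (hf (X τ)).hasDerivAt.comp_hasDerivWithinAt τ (H.position τ hτ)
  refine ((((hfX.pow 2).neg.mul hA).mul (H.velocity_fst τ hτ)).add
    (hB.mul (H.velocity_snd τ hτ))).congr_deriv ?_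
  have := (hpos (X τ)).ne'
  simp
  field_simp
  ring

/-- The analogue of `hasDerivWithinAt_tangential` for the parallel normal field
`(X' / f, f T')`. -/
theorem hasDerivWithinAt_normal (H : PlaneGeodesicSystem f I T' X X')
    (hf : Differentiable ℝ f) (hpos : ∀ x, 0 < f x) {A B : ℝ → ℝ} {P Q τ : ℝ} (hτ : τ ∈ I)
    (hA : HasDerivWithinAt A
      (P - deriv f (X τ) / f (X τ) * (T' τ * B τ + X' τ * A τ)) I τ)
    (hB : HasDerivWithinAt B (Q - f (X τ) * deriv f (X τ) * T' τ * A τ) I τ) :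
    HasDerivWithinAt (fun τ => f (X τ) * (B τ * T' τ - A τ * X' τ))
      (f (X τ) * (Q * T' τ - P * X' τ)) I τ := by
  have hfX := (hf (X τ)).hasDerivAt.comp_hasDerivWithinAt τ (H.position τ hτ)
  refine (hfX.mul ((hB.mul (H.velocity_fst τ hτ)).sub
    (hA.mul (H.velocity_snd τ hτ)))).congr_deriv ?_
  have := (hpos (X τ)).ne'
  simp
  field_simp
  ring

/-- A solution `(A, B)` of the Jacobi equation, with covariant derivative `(P, Q)`, along a
timelike geodesic starting at a maximum of `f` vanishes if it has two distinct zeros. -/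
theorem jacobi_eq_zero (H : PlaneGeodesicSystem f I T' X X') (hf : ContDiff ℝ ∞ f)
    (hpos : ∀ x, 0 < f x) (hI : Convex ℝ I) (h0 : 0 ∈ I) (hnonneg : ∀ τ ∈ I, 0 ≤ τ)
    (hmax : ∀ x, f x ≤ f (X 0)) (hneg : X' 0 ^ 2 - (f (X 0) * T' 0) ^ 2 < 0)
    {A B P Q : ℝ → ℝ}
    (hA : ∀ τ ∈ I, HasDerivWithinAt A
      (P τ - deriv f (X τ) / f (X τ) * (T' τ * B τ + X' τ * A τ)) I τ)
    (hB : ∀ τ ∈ I, HasDerivWithinAt B (Q τ - f (X τ) * deriv f (X τ) * T' τ * A τ) I τ)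
    (hP : ∀ τ ∈ I, HasDerivWithinAt P
      (deriv (deriv f) (X τ) / f (X τ) * ((-(f (X τ) * T' τ) ^ 2 + X' τ ^ 2) * A τ
          - (-(f (X τ)) ^ 2 * A τ * T' τ + B τ * X' τ) * T' τ)
        - deriv f (X τ) / f (X τ) * (T' τ * Q τ + X' τ * P τ)) I τ)
    (hQ : ∀ τ ∈ I, HasDerivWithinAt Q
      (deriv (deriv f) (X τ) / f (X τ) * ((-(f (X τ) * T' τ) ^ 2 + X' τ ^ 2) * B τ
          - (-(f (X τ)) ^ 2 * A τ * T' τ + B τ * X' τ) * X' τ)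
        - f (X τ) * deriv f (X τ) * T' τ * P τ) I τ)
    {a b : ℝ} (ha : a ∈ I) (hb : b ∈ I) (hab : a ≠ b) (hAa : A a = 0) (hBa : B a = 0)
    (hAb : A b = 0) (hBb : B b = 0) {τ : ℝ} (hτ : τ ∈ I) : A τ = 0 ∧ B τ = 0 := by
  have hfd : Differentiable ℝ f := hf.differentiable (by simp)
  have hEq : ∀ τ ∈ I, X' τ ^ 2 - (f (X τ) * T' τ) ^ 2 = X' 0 ^ 2 - (f (X 0) * T' 0) ^ 2 :=
    fun τ hτ => H.energy_eq hfd hpos hI hτ h0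
  set E := X' 0 ^ 2 - (f (X 0) * T' 0) ^ 2
  obtain ⟨v, v', hv, hv', hv0⟩ :=
    H.exists_nonvanishing_solution hf hpos hI h0 hnonneg hmax hneg hEq
  have hs : -(f (X τ)) ^ 2 * A τ * T' τ + B τ * X' τ = 0 :=
    hI.eq_zero_of_second_deriv_zero
      (s := fun τ => -(f (X τ)) ^ 2 * A τ * T' τ + B τ * X' τ)
      (fun σ hσ => H.hasDerivWithinAt_tangential hfd hpos hσ (hA σ hσ) (hB σ hσ))
      -- The second derivative is zero because the curvature term is orthogonal to the velocity.
      (fun σ hσ => (H.hasDerivWithinAt_tangential hfd hpos hσ (hP σ hσ) (hQ σ hσ)).congr_deriv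
        (by ring))
      ha hb hab (by simp [hAa, hBa]) (by simp [hAb, hBb]) hτ
  have hu : f (X τ) * (B τ * T' τ - A τ * X' τ) = 0 :=
    hI.eq_zero_of_nonvanishing_solution
      (u := fun τ => f (X τ) * (B τ * T' τ - A τ * X' τ))
      (q := fun τ => deriv (deriv f) (X τ) / f (X τ) * E)
      (fun σ hσ => H.hasDerivWithinAt_normal hfd hpos hσ (hA σ hσ) (hB σ hσ))
      (fun σ hσ => (H.hasDerivWithinAt_normal hfd hpos hσ (hP σ hσ) (hQ σ hσ)).congr_deriv
        (by simp only [← hEq σ hσ]; ring))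
      hv hv' hv0 ha hb hab (by simp [hAa, hBa]) (by simp [hAb, hBb]) hτ
  have hu' : B τ * T' τ - A τ * X' τ = 0 := by
    simpa [(hpos (X τ)).ne'] using hu
  -- `E` is, up to sign, the determinant of the linear system `hs`, `hu'` in `A τ`, `B τ`.
  have hE0 : X' τ ^ 2 - (f (X τ) * T' τ) ^ 2 ≠ 0 := by rw [hEq τ hτ]; exact hneg.ne
  constructor
  · refine (mul_eq_zero.1 ?_).resolve_left hE0
    linear_combination T' τ * hs - X' τ * hu'
  · refine (mul_eq_zero.1 ?_).resolve_left hE0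
    linear_combination X' τ * hs - f (X τ) ^ 2 * T' τ * hu'

end PlaneGeodesicSystem

/-! ### From covariant derivatives to the scalar systems. -/

theorem hasDerivWithinAt_derivWithin_apply {γ : ℝ → Fin 2 → ℝ} {τ : ℝ}
    (h : DifferentiableWithinAt ℝ γ I τ) (i : Fin 2) :
    HasDerivWithinAt (fun τ => γ τ i) (derivWithin γ I τ i) I τ :=
  (hasDerivWithinAt_pi.1 h.hasDerivWithinAt) i

/-- The components of a field along a curve in terms of its covariant derivative. -/
theorem hasDerivWithinAt_of_covDeriv (hf : ContDiff ℝ ∞ f) (hpos : ∀ x, 0 < f x)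
    {γ V : ℝ → Fin 2 → ℝ} {τ : ℝ} (h : DifferentiableWithinAt ℝ V I τ) {P : Fin 2 → ℝ}
    (hP : (planeMetric f hf hpos).covDeriv I γ V τ = P) :
    HasDerivWithinAt (fun τ => V τ 0) (P 0 - deriv f (γ τ 1) / f (γ τ 1) *
          (derivWithin γ I τ 0 * V τ 1 + derivWithin γ I τ 1 * V τ 0)) I τ ∧
      HasDerivWithinAt (fun τ => V τ 1)
        (P 1 - f (γ τ 1) * deriv f (γ τ 1) * derivWithin γ I τ 0 * V τ 0) I τ := by
  subst hP
  rw [planeMetric_covDeriv]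
  exact ⟨(hasDerivWithinAt_derivWithin_apply h 0).congr_deriv (by simp),
    (hasDerivWithinAt_derivWithin_apply h 1).congr_deriv (by simp)⟩

theorem LorentzMetric.IsGeodesicOn.planeGeodesicSystem {hf : ContDiff ℝ ∞ f}
    {hpos : ∀ x, 0 < f x} {γ : ℝ → Fin 2 → ℝ} (hI : UniqueDiffOn ℝ I)
    (hγ : (planeMetric f hf hpos).IsGeodesicOn I γ) :
    PlaneGeodesicSystem f I (fun τ => derivWithin γ I τ 0) (fun τ => γ τ 1)
      (fun τ => derivWithin γ I τ 1) := by
  have h1 : DifferentiableOn ℝ γ I := hγ.1.differentiableOn (by simp)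
  have h2 : DifferentiableOn ℝ (derivWithin γ I) I :=
    ((contDiffOn_infty_iff_derivWithin hI).1 hγ.1).2.differentiableOn (by simp)
  have h3 := fun τ hτ => hasDerivWithinAt_of_covDeriv hf hpos (h2 τ hτ) (hγ.2 τ hτ)
  exact ⟨fun τ hτ => hasDerivWithinAt_derivWithin_apply (h1 τ hτ) 1,
    fun τ hτ => (h3 τ hτ).1.congr_deriv (by simp), fun τ hτ => (h3 τ hτ).2.congr_deriv (by simp)⟩

/-- The Jacobi equation contains `derivWithin` of `DJ/dτ`, which is a genuine derivative only once
`DJ/dτ` is known to be differentiable. -/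
theorem differentiableOn_planeMetric_covDeriv (hf : ContDiff ℝ ∞ f) (hpos : ∀ x, 0 < f x)
    {γ V : ℝ → Fin 2 → ℝ} (hI : UniqueDiffOn ℝ I) (hγ : ContDiffOn ℝ ∞ γ I)
    (hV : ContDiffOn ℝ ∞ V I) :
    DifferentiableOn ℝ ((planeMetric f hf hpos).covDeriv I γ V) I := by
  have hfd : Differentiable ℝ f := hf.differentiable (by simp)
  have hf'd : Differentiable ℝ (deriv f) :=
    (contDiff_infty_iff_deriv.1 hf).2.differentiable (by simp)
  have comp {W : ℝ → Fin 2 → ℝ} (hW : ContDiffOn ℝ ∞ W I) (i : Fin 2) :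
      DifferentiableOn ℝ (fun τ => W τ i) I :=
    differentiableOn_pi.1 (hW.differentiableOn (by simp)) i
  have comp' {W : ℝ → Fin 2 → ℝ} (hW : ContDiffOn ℝ ∞ W I) (i : Fin 2) :
      DifferentiableOn ℝ (fun τ => derivWithin W I τ i) I :=
    comp ((contDiffOn_infty_iff_derivWithin hI).1 hW).2 i
  have hfγ : DifferentiableOn ℝ (fun τ => f (γ τ 1)) I := hfd.comp_differentiableOn (comp hγ 1)
  have hf'γ : DifferentiableOn ℝ (fun τ => deriv f (γ τ 1)) I :=
    hf'd.comp_differentiableOn (comp hγ 1)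
  rw [differentiableOn_pi]
  intro i
  simp only [planeMetric_covDeriv]
  fin_cases i
  · exact (comp' hV 0).add ((hf'γ.div hfγ fun τ _ => (hpos _).ne').mul
      (((comp' hγ 0).mul (comp hV 1)).add ((comp' hγ 1).mul (comp hV 0))))
  · exact (comp' hV 1).add (((hfγ.mul hf'γ).mul (comp' hγ 0)).mul (comp hV 0))

end

theorem mainTheorem10 (f : ℝ → ℝ) (hf : ContDiff ℝ ∞ f)
    (m M : ℝ) (hm : 0 < m) (hlow : ∀ x, m ≤ f x) (hup : ∀ x, f x ≤ M)
    (t₀ x₀ : ℝ) (hx₀ : f x₀ = ⨆ x, f x) :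
    (planeMetric f hf (fun x => hm.trans_le (hlow x))).IsTimelikePole ![t₀, x₀] := by
  have hpos : ∀ x, 0 < f x := fun x => hm.trans_le (hlow x)
  rintro a γ ha hγ htl hγ0 τ₁ hτ₁ τ₂ hτ₂ ⟨hne, J, ⟨hJ, hJac⟩, hJ₁, hJ₂, τ, hτ, hJτ⟩
  have hU := LorentzMetric.uniqueDiffOn_halfOpen ha
  have hconv := LorentzMetric.convex_halfOpen a
  have h0 : (0 : ℝ) ∈ LorentzMetric.halfOpen a := ⟨le_rfl, by exact_mod_cast ha⟩
  have hmax : ∀ x, f x ≤ f (γ 0 1) := fun x => by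
    rw [hγ0]
    simpa [hx₀] using le_ciSup (f := f) ⟨M, Set.forall_mem_range.2 hup⟩ x
  have hneg := htl 0 h0
  rw [planeMetric_inner] at hneg
  have hJd : DifferentiableOn ℝ J (LorentzMetric.halfOpen a) := hJ.differentiableOn (by simp)
  have hDJ := differentiableOn_planeMetric_covDeriv hf hpos hU hγ.1 hJ
  have h1 := fun τ hτ => hasDerivWithinAt_of_covDeriv hf hpos (γ := γ) (hJd τ hτ) rfl
  -- The Jacobi equation, read as a first-order equation for the field `DJ/dτ`.
  have h2 := fun τ hτ => hasDerivWithinAt_of_covDeriv hf hpos (γ := γ) (hDJ τ hτ)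
    (eq_neg_of_add_eq_zero_left (hJac τ hτ))
  have key := (hγ.planeGeodesicSystem hU).jacobi_eq_zero hf hpos hconv h0 (fun τ hτ => hτ.1)
    hmax (by linarith) (fun τ hτ => (h1 τ hτ).1) (fun τ hτ => (h1 τ hτ).2)
    (fun τ hτ => (h2 τ hτ).1.congr_deriv
      (by
        rw [planeMetric_curvature]
        simp only [Pi.neg_apply, Pi.smul_apply, Pi.sub_apply, smul_eq_mul]
        ring))
    (fun τ hτ => (h2 τ hτ).2.congr_deriv
      (by
        rw [planeMetric_curvature]
        simp only [Pi.neg_apply, Pi.smul_apply, Pi.sub_apply, smul_eq_mul]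
        ring))
    hτ₁ hτ₂ hne (by simp [hJ₁]) (by simp [hJ₁]) (by simp [hJ₂]) (by simp [hJ₂]) hτ
  apply hJτ
  ext i
  fin_cases i
  · exact key.1
  · exact key.2
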